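/- Let $L>0$. Let $f:\mathbb{R}^d\to\mathbb{R}$ be bounded below with $f^*=\inf f$, and $L$-smooth in the sense that $f$ is differentiable and \[ f(y)\le f(x)+\langle\nabla f(x),y-x\rangle+\tfrac L2\|y-x\|^2\qquad\text{for all }x,y\in\mathbb{R}^d. \] **Algorithm (Multistage SGDM).** Let $n\ge1$ be the number of stages; stage $l$ $(1\le l\le n)$ has step size $\alpha_l$, momentum weight $\beta_l$ and length $T_l\in\mathbb{N}$. Put $S_l=T_1+\dots+T_l$, $S_0=0$, and for $S_{l-1}<k\le S_l$ write $\alpha(k)=\alpha_l$, $\beta(k)=\beta_l$. Starting from a deterministic point $x^1\in\mathbb{R}^d$ and $m^0=0$, for $k=1,\dots,S_n$ draw a sample $\zeta^k$, form the stochastic gradient $\tilde g^k=g(x^k,\zeta^k)$ (with $g$ a jointly measurable function), and set \[ m^k=\beta(k)\,m^{k-1}+(1-\beta(k))\,\tilde g^k,\qquad x^{k+1}=x^k-\alpha(k)\,m^k . \] **Stochastic gradients.** The samples $\zeta^1,\zeta^2,\dots$ are independent and, for every iteration $k$, almost surely \[ \mathbb{E}_{\zeta^k}[\tilde g^k]=\nabla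 f(x^k),\qquad \mathbb{E}_{\zeta^k}\big[\|\tilde g^k-\nabla f(x^k)\|^2\big]\le\sigma^2, \] where $\mathbb{E}_{\zeta^k}$ is the expectation over $\zeta^k$ alone, with $x^k$ held fixed. **Parameters.** Assume that for all $i=1,\dots,n$ \[ \frac{\alpha_i\beta_i}{1-\beta_i}=A_1:=\frac{1}{24\sqrt2\,L},\qquad \alpha_iT_i=A_2,\qquad \beta_i^{2T_i}\le\frac12, \] that $\frac12\le\beta_1\le\beta_2\le\dots\le\beta_n<1$, and that \[ \frac{1-\beta_1}{\beta_1}\le12\,\frac{1-\beta_n}{\sqrt{\beta_n+\beta_n^2}} . \] **Theorem.** The expectations $\mathbb{E}\|\nabla f(x^k)\|^2$, $1\le k\le S_n$, are finite, and \[ \frac1n\sum_{l=1}^n\frac1{T_l}\sum_{i=S_{l-1}+1}^{S_l}\mathbb{E}\|\nabla f(x^i)\|^2\ \le\ \frac{2(f(x^1)-f^*)}{nA_2}+\frac1n\sum_{l=1}^n\left(24\,\beta_l^2\,\frac{\beta_1}{\sqrt{\beta_n+\beta_n^2}}+3\right)L\,\alpha_l\,\sigma^2 . \] The right-hand side is $\mathcal{O}\!\left(\frac{f(x^1)-f^*}{nA_2}+\frac1n\sum_{l=1}^nL\alpha_l\sigma^2\right)$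 with an absolute constant; in fact it is at most \[ 20\left(\frac{f(x^1)-f^*}{nA_2}+\frac1n\sum_{l=1}^nL\alpha_l\sigma^2\right). \] -/

import Mathlib

open MeasureTheory ProbabilityTheory

noncomputable section

namespace MultistageSGDM

/-- `f : ℝᵈ → ℝ` is `L`-smooth: `L ≥ 0`, `f` is differentiable, and
`f y ≤ f x + ⟨∇f x, y - x⟩ + (L/2) ‖y - x‖²` for all `x, y`. -/
def IsLSmooth {d : ℕ} (L : ℝ) (f : EuclideanSpace ℝ (Fin d) → ℝ) : Prop :=
  0 ≤ L ∧ Differentiable ℝ f ∧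
    ∀ x y, f y ≤ f x + inner ℝ (gradient f x) (y - x) + L / 2 * ‖y - x‖ ^ 2

/-- `stageEnd T l = T₁ + ⋯ + T_l`, the last iteration of stage `l` (and `0` for `l = 0`). -/
def stageEnd (T : ℕ → ℕ) (l : ℕ) : ℕ := ∑ i ∈ Finset.Icc 1 l, T i

/-- The stage to which iteration `k` belongs: one plus the number of stages that are over
before iteration `k`. For `T₁ + ⋯ + T_{l-1} < k ≤ T₁ + ⋯ + T_l` with `1 ≤ l ≤ n` this is `l`. -/
def stageOf (n : ℕ) (T : ℕ → ℕ) (k : ℕ) : ℕ :=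
  1 + ((Finset.Icc 1 n).filter fun l => stageEnd T l < k).card

/-- The state of Multistage SGDM after `k` iterations, i.e. the pair `(xᵏ⁺¹, mᵏ)`.
There are `n` stages; stage `i` (`1 ≤ i ≤ n`) has step size `α i`, momentum weight `β i` and
length `T i`. The starting point is `x¹ = x₁`, `m⁰ = 0`. The stochastic gradient used in
iteration `k` is `g xᵏ (ζ k)`, where `ζ k` is the sample drawn in that iteration. -/
def state {d : ℕ} {Ω Z : Type*} (n : ℕ) (α β : ℕ → ℝ) (T : ℕ → ℕ)
    (g : EuclideanSpace ℝ (Fin d) → Z → EuclideanSpace ℝ (Fin d)) (ζ : ℕ → Ω → Z)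
    (x₁ : EuclideanSpace ℝ (Fin d)) :
    ℕ → Ω → EuclideanSpace ℝ (Fin d) × EuclideanSpace ℝ (Fin d)
  | 0, _ => (x₁, 0)
  | k + 1, ω =>
    let s := state n α β T g ζ x₁ k ω
    let a := α (stageOf n T (k + 1))
    let b := β (stageOf n T (k + 1))
    let m := b • s.2 + (1 - b) • g s.1 (ζ (k + 1) ω)
    (s.1 - a • m, m)

/-- The iterate `xᵏ` of Multistage SGDM, for `k ≥ 1`. -/
def iterate {d : ℕ} {Ω Z : Type*} (n : ℕ) (α β : ℕ → ℝ) (T : ℕ → ℕ)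
    (g : EuclideanSpace ℝ (Fin d) → Z → EuclideanSpace ℝ (Fin d)) (ζ : ℕ → Ω → Z)
    (x₁ : EuclideanSpace ℝ (Fin d)) (k : ℕ) (ω : Ω) : EuclideanSpace ℝ (Fin d) :=
  (state n α β T g ζ x₁ (k - 1) ω).1

/-- The right-hand side
`2 Δ / (n A₂) + (1/n) ∑_{l=1}^n (24 β_l² β₁ / √(β_n + β_n²) + 3) L α_l σ²`. -/
def bound (n : ℕ) (α β : ℕ → ℝ) (A₂ L σ Δ : ℝ) : ℝ :=
  2 * Δ / (n * A₂) +
    1 / n * ∑ l ∈ Finset.Icc 1 n,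
      (24 * β l ^ 2 * (β 1 / √(β n + β n ^ 2)) * L + 3 * L) * α l * σ ^ 2

end MultistageSGDM

end

/-! The quantity `α β / (1 - β)` has the same value `A` in every stage, so one Lyapunov function, `f
x - A ⟨∇f x, m⟩ + (3/2) L A² ‖m‖²`, serves the whole run and its decrease telescopes across stage
boundaries. It dominates `f (x - A m)`, hence `inf f`.

`IsLSmooth.exists_lyapunov_momentumStep_le` is the deterministic core: with noise `w`, one step of
size `a` lowers the function by `(19/20) a ‖∇f x‖²`, up to a term linear in `w` and `(3/2) L a²
‖w‖²`. The state depends only on earlier samples, so the linear term has mean zero and the quadratic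
one costs at most `(3/2) L a² σ²`.

Summing over all iterations and using `α_l T_l = A₂`, the weighted gradient sum becomes `A₂` times
the sum of stage averages, and the sum of squared step sizes becomes `A₂ ∑ α_l`. Dividing by `n A₂`
leaves a bound stronger than the stated one. -/

namespace MultistageSGDM

/-! ### Smoothness and the deterministic Lyapunov decrease -/

section Smooth

variable {d : ℕ} {L : ℝ} {f : EuclideanSpace ℝ (Fin d) → ℝ}

lemma measurable_gradient : Measurable (gradient f) := by
  have : gradient f = fun x => (InnerProductSpace.toDual ℝ _).symm (fderiv ℝ f x) := rfl
  rw [this]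
  exact (LinearIsometryEquiv.continuous _).measurable.comp (measurable_fderiv ℝ f)

/-- The gradient of an `L`-smooth function is one-sided Lipschitz. -/
lemma IsLSmooth.inner_gradient_sub_le (hf : IsLSmooth L f) (x y : EuclideanSpace ℝ (Fin d)) :
    inner ℝ (gradient f y) (y - x) ≤ inner ℝ (gradient f x) (y - x) + L * ‖y - x‖ ^ 2 := by
  have h1 := hf.2.2 x y
  have h2 := hf.2.2 y x
  rw [← neg_sub y x, inner_neg_right, norm_neg] at h2
  linarith

/-- The point `x - L⁻¹ ∇f x` minimises the quadratic upper bound at `x`, and `f` there is still at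
least its infimum. This later turns integrability of `f (xᵏ)` into square integrability of the
gradient. -/
lemma IsLSmooth.norm_gradient_sq_le (hf : IsLSmooth L f) (hL : 0 < L)
    (hbdd : BddBelow (Set.range f)) (x : EuclideanSpace ℝ (Fin d)) :
    ‖gradient f x‖ ^ 2 ≤ 2 * L * (f x - ⨅ y, f y) := by
  have h1 := hf.2.2 x (x - L⁻¹ • gradient f x)
  have h2 := ciInf_le hbdd (x - L⁻¹ • gradient f x)
  rw [sub_sub_cancel_left, inner_neg_right, norm_neg, inner_smul_right, norm_smul,
    real_inner_self_eq_norm_sq, mul_pow, Real.norm_eq_abs, sq_abs] at h1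
  have h3 : L⁻¹ * ‖gradient f x‖ ^ 2 / 2 ≤ f x - ⨅ y, f y := by
    have : L / 2 * (L⁻¹ ^ 2 * ‖gradient f x‖ ^ 2) = L⁻¹ * ‖gradient f x‖ ^ 2 / 2 := by
      field_simp
    linarith
  calc ‖gradient f x‖ ^ 2 = 2 * L * (L⁻¹ * ‖gradient f x‖ ^ 2 / 2) := by field_simp
    _ ≤ _ := by gcongr

/-- The Lyapunov function `f x - A ⟨∇f x, m⟩ + (3/2) L A² ‖m‖²` of the pair of an iterate `x` and
a momentum `m`. -/
noncomputable def lyapunov (L A : ℝ) (f : EuclideanSpace ℝ (Fin d) → ℝ)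
    (s : EuclideanSpace ℝ (Fin d) × EuclideanSpace ℝ (Fin d)) : ℝ :=
  f s.1 - A * inner ℝ (gradient f s.1) s.2 + 3 / 2 * L * A ^ 2 * ‖s.2‖ ^ 2

/-- Smoothness from `x` to the auxiliary point `x - A m` gives the same expression with `1/2` in
place of `3/2` as an upper bound for `f (x - A m)`. -/
lemma IsLSmooth.iInf_le_lyapunov (hf : IsLSmooth L f) (hbdd : BddBelow (Set.range f)) (A : ℝ)
    (s : EuclideanSpace ℝ (Fin d) × EuclideanSpace ℝ (Fin d)) :
    ⨅ y, f y ≤ lyapunov L A f s := by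
  have h1 := hf.2.2 s.1 (s.1 - A • s.2)
  have h2 := ciInf_le hbdd (s.1 - A • s.2)
  rw [sub_sub_cancel_left, inner_neg_right, norm_neg, inner_smul_right, norm_smul, mul_pow,
    Real.norm_eq_abs, sq_abs] at h1
  have h3 : 0 ≤ L * (A ^ 2 * ‖s.2‖ ^ 2) := mul_nonneg hf.1 (by positivity)
  unfold lyapunov
  linarith

/-- One step of gradient descent with momentum from the pair of the iterate and the momentum, with
step size `a`, momentum weight `b` and gradient estimate `v`. -/
def momentumStep (a b : ℝ) (s : EuclideanSpace ℝ (Fin d) × EuclideanSpace ℝ (Fin d))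
    (v : EuclideanSpace ℝ (Fin d)) : EuclideanSpace ℝ (Fin d) × EuclideanSpace ℝ (Fin d) :=
  (s.1 - a • (b • s.2 + (1 - b) • v), b • s.2 + (1 - b) • v)

/-- One step of stochastic gradient descent with momentum decreases the Lyapunov function, up to
terms that come from the noise `w`. -/
lemma IsLSmooth.exists_lyapunov_momentumStep_le (hf : IsLSmooth L f) {A a b : ℝ}
    (hLA : L * A ≤ 1 / 30) (ha : 0 ≤ a) (haA : a ≤ A) (hb0 : 0 ≤ b) (hb1 : b ≤ 1)
    (hab : a * b = (1 - b) * A) :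
    ∃ c₁ c₂ : ℝ, ∀ (s : EuclideanSpace ℝ (Fin d) × EuclideanSpace ℝ (Fin d))
      (w : EuclideanSpace ℝ (Fin d)),
      lyapunov L A f (momentumStep a b s (gradient f s.1 + w)) ≤
        lyapunov L A f s - 19 / 20 * a * ‖gradient f s.1‖ ^ 2
          + inner ℝ (c₁ • gradient f s.1 + c₂ • s.2) w + 3 / 2 * L * a ^ 2 * ‖w‖ ^ 2 := by
  have hL := hf.1
  have hA : 0 ≤ A := ha.trans haA
  -- `K` collects all coefficients of `‖m'‖²`: the Lyapunov term, the smoothness error of `f`, and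
  -- the error of moving `∇f` from the new iterate back to `x`. The witnesses below are the
  -- coefficients of the terms linear in `w`.
  obtain ⟨K, hK⟩ : ∃ K, K = 3 / 2 * L * A ^ 2 + L * a ^ 2 / 2 + A * L * a := ⟨_, rfl⟩
  refine ⟨2 * K * (1 - b) * (1 - b) - a, 2 * K * (1 - b) * b, fun ⟨x, m⟩ w => ?_⟩
  have e1 : (a + A) * (1 - b) = a := by linear_combination -hab
  have e2 : (a + A) * b = A := by linear_combination hab
  have hb : 0 ≤ 1 - b := by linarith
  have hLAa : 0 ≤ L * A * a := by positivity
  -- The old momentum term can be absorbed. The factor `3/2` is what makes this close: `a b = (1 -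
  -- b) A` and `a ≤ A` bound the two error terms by `(3/2) L A² (1 - b)`.
  have hK1 : K * b ≤ 3 / 2 * L * A ^ 2 := by
    have : K * b = 3 / 2 * L * A ^ 2 * b + L * (a * b) * (a / 2 + A) := by rw [hK]; ring
    rw [this, hab]
    have : 0 ≤ L * ((1 - b) * A) * (A - a) := by
      have := sub_nonneg.2 haA
      positivity
    linarith
  have hK0 : K ≤ 3 / 2 * L * A * (a + A) := by
    have : 0 ≤ L * a * (A - a) := by
      have := sub_nonneg.2 haA
      positivity
    rw [hK]; linarith
  have hK2 : K * (1 - b) ≤ 3 / 2 * L * A * a := by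
    calc K * (1 - b) ≤ 3 / 2 * L * A * (a + A) * (1 - b) := by gcongr
      _ = 3 / 2 * L * A * ((a + A) * (1 - b)) := by ring
      _ = _ := by rw [e1]
  -- This is the loss from `a` to `(19/20) a` in the gradient term: `(3/2) · (1/30) = 1/20`.
  have hK3 : K * (1 - b) ≤ a / 20 := by
    have : L * A * a ≤ 1 / 30 * a := by gcongr
    linarith
  have hK4 : K * (1 - b) ^ 2 ≤ 3 / 2 * L * a ^ 2 := by
    calc K * (1 - b) ^ 2 = K * (1 - b) * (1 - b) := by ring
      _ ≤ 3 / 2 * L * A * a * (1 - b) := by gcongr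
      _ = 3 / 2 * L * a * ((1 - b) * A) := by ring
      _ = 3 / 2 * L * a ^ 2 * b := by rw [← hab]; ring
      _ ≤ 3 / 2 * L * a ^ 2 * 1 := by gcongr
      _ = _ := mul_one _
  obtain ⟨G, hG⟩ : ∃ G, G = gradient f x := ⟨_, rfl⟩
  obtain ⟨m', hm'⟩ : ∃ m', m' = b • m + (1 - b) • (G + w) := ⟨_, rfl⟩
  simp only [lyapunov, momentumStep, ← hG, ← hm']
  have h1 := hf.2.2 x (x - a • m')
  have h2 := hf.inner_gradient_sub_le x (x - a • m')
  rw [sub_sub_cancel_left, inner_neg_right, norm_neg, inner_smul_right, norm_smul, mul_pow,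
    Real.norm_eq_abs, sq_abs, ← hG] at h1
  rw [sub_sub_cancel_left, inner_neg_right, inner_neg_right, norm_neg, inner_smul_right,
    inner_smul_right, norm_smul, mul_pow, Real.norm_eq_abs, sq_abs, ← hG] at h2
  -- The one-sided Lipschitz bound along `-a m'` carries a factor `a`, which is divided out; for `a
  -- = 0` the two points coincide.
  have h3 : A * inner ℝ G m' - A * L * a * ‖m'‖ ^ 2
      ≤ A * inner ℝ (gradient f (x - a • m')) m' := by
    rcases ha.eq_or_lt with rfl | ha'
    · simp [← hG]
    have : inner ℝ G m' - L * a * ‖m'‖ ^ 2 ≤ inner ℝ (gradient f (x - a • m')) m' := by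
      refine le_of_mul_le_mul_left ?_ ha'
      linarith
    linarith [mul_le_mul_of_nonneg_left this hA]
  have i1 : inner ℝ G m' = b * inner ℝ G m + (1 - b) * (‖G‖ ^ 2 + inner ℝ G w) := by
    rw [hm', inner_add_right, inner_smul_right, inner_smul_right, inner_add_right,
      real_inner_self_eq_norm_sq]
  have i2 : ‖m'‖ ^ 2 = b ^ 2 * ‖m‖ ^ 2 + (1 - b) ^ 2 * ‖G‖ ^ 2 + (1 - b) ^ 2 * ‖w‖ ^ 2
      + 2 * b * (1 - b) * inner ℝ G m + 2 * b * (1 - b) * inner ℝ m w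
      + 2 * (1 - b) ^ 2 * inner ℝ G w := by
    simp only [← real_inner_self_eq_norm_sq, hm', inner_add_left, inner_add_right,
      inner_smul_left, inner_smul_right, conj_trivial]
    rw [real_inner_comm G m, real_inner_comm m w, real_inner_comm G w]
    ring
  have i3 : 0 ≤ ‖m‖ ^ 2 - 2 * inner ℝ G m + ‖G‖ ^ 2 := by
    have := norm_sub_sq_real m G
    rw [real_inner_comm] at this
    rw [← this]; positivity
  rw [inner_add_left, real_inner_smul_left, real_inner_smul_left]
  have hKnn : 0 ≤ K := by rw [hK]; positivity
  -- Convexity of the squared norm: `‖b m + (1 - b) G‖² ≤ b ‖m‖² + (1 - b) ‖G‖²`, with defect `b (1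
  -- - b) ‖m - G‖²`.
  have j0 : 0 ≤ K * (b * (1 - b)) * (‖m‖ ^ 2 - 2 * inner ℝ G m + ‖G‖ ^ 2) := by positivity
  have j1 := mul_le_mul_of_nonneg_right hK1 (sq_nonneg ‖m‖)
  have j3 := mul_le_mul_of_nonneg_right hK3 (sq_nonneg ‖G‖)
  have j4 := mul_le_mul_of_nonneg_right hK4 (sq_nonneg ‖w‖)
  have j5 : f (x - a • m') - A * inner ℝ (gradient f (x - a • m')) m'
      + 3 / 2 * L * A ^ 2 * ‖m'‖ ^ 2 ≤ f x - (a + A) * inner ℝ G m' + K * ‖m'‖ ^ 2 := by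
    rw [hK]; linarith
  have j6 : (a + A) * inner ℝ G m' = A * inner ℝ G m + a * ‖G‖ ^ 2 + a * inner ℝ G w := by
    rw [i1]
    linear_combination (inner ℝ G m) * e2 + (‖G‖ ^ 2 + inner ℝ G w) * e1
  have j7 : K * ‖m'‖ ^ 2 = _ := congrArg (K * ·) i2
  rw [j6, j7] at j5
  linarith

end Smooth

/-! ### Integrability and the expected decrease in one step -/

section Expectation

variable {d : ℕ} {Ω Z : Type*} [MeasurableSpace Ω] [MeasurableSpace Z]
  {μ : Measure Ω}

/-- Independence allows the sample to be redrawn on a second copy of `Ω`; Fubini then brings in the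
hypotheses stated with the state held fixed. -/
lemma identDistrib_prodMk_of_indepFun [IsProbabilityMeasure μ] {S : Type*} [MeasurableSpace S]
    {s : Ω → S} {ζ : Ω → Z} (hs : Measurable s) (hζ : Measurable ζ) (h : IndepFun s ζ μ) :
    IdentDistrib (fun ω => (s ω, ζ ω)) (Prod.map s ζ) μ (μ.prod μ) where
  aemeasurable_fst := (hs.prodMk hζ).aemeasurable
  aemeasurable_snd := (hs.prodMap hζ).aemeasurable
  map_eq := by
    rw [(indepFun_iff_map_prod_eq_prod_map_map hs.aemeasurable hζ.aemeasurable).1 h,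
      Measure.map_prod_map _ _ hs hζ]

/-- If the squared norm of `h (s, ζ)` has expectation at most `c` over `ζ` with `s` fixed, the same
holds for the full expectation, for independent `s` and `ζ`. -/
lemma integral_norm_sq_le_of_indepFun [IsProbabilityMeasure μ] {S E : Type*}
    [MeasurableSpace S] [NormedAddCommGroup E] [MeasurableSpace E] [BorelSpace E] {s : Ω → S} {ζ : Ω → Z}
    (hs : Measurable s) (hζ : Measurable ζ) (hindep : IndepFun s ζ μ) {h : S × Z → E}
    (hh : Measurable h) {c : ℝ}
    (hc : ∀ᵐ ω ∂μ, Integrable (fun ω' => ‖h (s ω, ζ ω')‖ ^ 2) μ ∧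
      ∫ ω', ‖h (s ω, ζ ω')‖ ^ 2 ∂μ ≤ c) :
    Integrable (fun ω => ‖h (s ω, ζ ω)‖ ^ 2) μ ∧ ∫ ω, ‖h (s ω, ζ ω)‖ ^ 2 ∂μ ≤ c := by
  have hF : Measurable fun p : S × Z => ‖h p‖ ^ 2 := hh.norm.pow_const 2
  have hid := (identDistrib_prodMk_of_indepFun hs hζ hindep).comp hF
  have hmeas : Measurable ((fun p : S × Z => ‖h p‖ ^ 2) ∘ Prod.map s ζ) :=
    hF.comp (hs.prodMap hζ)
  have hint : Integrable ((fun p : S × Z => ‖h p‖ ^ 2) ∘ Prod.map s ζ) (μ.prod μ) := by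
    rw [integrable_prod_iff hmeas.aestronglyMeasurable]
    refine ⟨hc.mono fun ω hω => hω.1, ?_⟩
    -- The inner integral is almost surely in `[0, c]`, so it is integrable over a probability
    -- space.
    refine Integrable.of_bound
      (hmeas.stronglyMeasurable.norm.integral_prod_right'.aestronglyMeasurable) c ?_
    filter_upwards [hc] with ω hω
    have h0 : 0 ≤ ∫ ω', ‖h (s ω, ζ ω')‖ ^ 2 ∂μ := integral_nonneg fun ω' => by positivity
    simpa [abs_of_nonneg h0] using hω.2
  refine ⟨hid.integrable_iff.2 hint, ?_⟩
  calc ∫ ω, ‖h (s ω, ζ ω)‖ ^ 2 ∂μ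
      = ∫ p, ((fun p : S × Z => ‖h p‖ ^ 2) ∘ Prod.map s ζ) p ∂(μ.prod μ) := hid.integral_eq
    _ = ∫ ω, ∫ ω', ‖h (s ω, ζ ω')‖ ^ 2 ∂μ ∂μ := integral_prod _ hint
    _ ≤ ∫ _, c ∂μ := integral_mono_ae hint.integral_prod_left (integrable_const c)
        (hc.mono fun ω hω => hω.2)
    _ = c := by simp

/-- A square-integrable noise `h (s, ζ)` that is centred over `ζ` with `s` fixed is orthogonal to
the square-integrable functions of `s`, for independent `s` and `ζ`. -/
lemma integral_inner_eq_zero_of_indepFun [IsProbabilityMeasure μ] {S : Type*}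
    [MeasurableSpace S] {s : Ω → S} {ζ : Ω → Z}
    (hs : Measurable s) (hζ : Measurable ζ) (hindep : IndepFun s ζ μ)
    {h : S × Z → EuclideanSpace ℝ (Fin d)} (hh : Measurable h)
    {u : S → EuclideanSpace ℝ (Fin d)} (hu : Measurable u)
    (hu2 : MemLp (fun ω => u (s ω)) 2 μ) (hh2 : MemLp (fun ω => h (s ω, ζ ω)) 2 μ)
    (hc : ∀ᵐ ω ∂μ, Integrable (fun ω' => h (s ω, ζ ω')) μ ∧ ∫ ω', h (s ω, ζ ω') ∂μ = 0) :
    Integrable (fun ω => inner ℝ (u (s ω)) (h (s ω, ζ ω))) μ ∧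
      ∫ ω, inner ℝ (u (s ω)) (h (s ω, ζ ω)) ∂μ = 0 := by
  have hI : Integrable (fun ω => inner ℝ (u (s ω)) (h (s ω, ζ ω))) μ := by
    refine Integrable.mono' (hu2.norm.integrable_mul hh2.norm)
      (hu2.1.inner hh2.1) (.of_forall fun ω => norm_inner_le_norm _ _)
  have hF : Measurable fun p : S × Z => (inner ℝ (u p.1) (h p) : ℝ) :=
    (hu.comp measurable_fst).inner hh
  have hid := (identDistrib_prodMk_of_indepFun hs hζ hindep).comp hF
  have hint := hid.integrable_iff.1 hI
  refine ⟨hI, hid.integral_eq.trans ?_⟩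
  rw [integral_prod _ hint]
  refine integral_eq_zero_of_ae ?_
  filter_upwards [hc] with ω hω
  simp only [Function.comp_apply, Prod.map_apply, Pi.zero_apply]
  rw [integral_inner hω.1, hω.2, inner_zero_right]

variable {L : ℝ} {f : EuclideanSpace ℝ (Fin d) → ℝ}

lemma IsLSmooth.memLp_gradient [IsProbabilityMeasure μ] (hf : IsLSmooth L f) (hL : 0 < L)
    (hbdd : BddBelow (Set.range f))
    {X : Ω → EuclideanSpace ℝ (Fin d)} (hX : Measurable X)
    (hfX : Integrable (fun ω => f (X ω)) μ) : MemLp (fun ω => gradient f (X ω)) 2 μ := by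
  have hmeas := (measurable_gradient (f := f)).comp hX
  refine (memLp_two_iff_integrable_sq_norm hmeas.aestronglyMeasurable).2 ?_
  refine Integrable.mono' ((hfX.sub (integrable_const (⨅ y, f y))).const_mul (2 * L))
    (hmeas.norm.pow_const 2).aestronglyMeasurable (.of_forall fun ω => ?_)
  rw [Real.norm_of_nonneg (by positivity)]
  exact hf.norm_gradient_sq_le hL hbdd _

/-- The value is squeezed between `inf f` and the smoothness upper bound. This propagates
integrability of `f (xᵏ)` from one iterate to the next. -/
lemma IsLSmooth.integrable_comp_sub [IsProbabilityMeasure μ] (hf : IsLSmooth L f)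
    (hbdd : BddBelow (Set.range f))
    {X V : Ω → EuclideanSpace ℝ (Fin d)} (hX : Measurable X) (hV : Measurable V)
    (hfX : Integrable (fun ω => f (X ω)) μ) (hGX : MemLp (fun ω => gradient f (X ω)) 2 μ)
    (hV2 : MemLp V 2 μ) : Integrable (fun ω => f (X ω - V ω)) μ := by
  have hmeas : Measurable fun ω => f (X ω - V ω) :=
    hf.2.1.continuous.measurable.comp (hX.sub hV)
  have h1 : Integrable (fun ω => f (X ω) + ‖gradient f (X ω)‖ * ‖V ω‖ + L / 2 * ‖V ω‖ ^ 2) μ :=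
    (hfX.add (hGX.norm.integrable_mul hV2.norm)).add
      (((memLp_two_iff_integrable_sq_norm hV2.1).1 hV2).const_mul _)
  refine integrable_of_le_of_le hmeas.aestronglyMeasurable
    (.of_forall fun ω => ciInf_le hbdd (X ω - V ω)) (.of_forall fun ω => ?_)
    (integrable_const _) h1
  have h2 := hf.2.2 (X ω) (X ω - V ω)
  rw [sub_sub_cancel_left, norm_neg] at h2
  have h3 := real_inner_le_norm (gradient f (X ω)) (-V ω)
  rw [norm_neg] at h3
  dsimp only
  linarith

lemma integrable_lyapunov (A : ℝ)
    {s : Ω → EuclideanSpace ℝ (Fin d) × EuclideanSpace ℝ (Fin d)}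
    (hfs : Integrable (fun ω => f (s ω).1) μ) (hG : MemLp (fun ω => gradient f (s ω).1) 2 μ)
    (hm : MemLp (fun ω => (s ω).2) 2 μ) : Integrable (fun ω => lyapunov L A f (s ω)) μ := by
  have h1 : Integrable (fun ω => (inner ℝ (gradient f (s ω).1) (s ω).2 : ℝ)) μ :=
    Integrable.mono' (hG.norm.integrable_mul hm.norm) (hG.1.inner hm.1)
      (.of_forall fun ω => norm_inner_le_norm _ _)
  exact (hfs.sub (h1.const_mul A)).add
    (((memLp_two_iff_integrable_sq_norm hm.1).1 hm).const_mul _)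

/-- The expected decrease of the Lyapunov function in one step. -/
lemma IsLSmooth.integral_lyapunov_momentumStep_le [IsProbabilityMeasure μ]
    (hf : IsLSmooth L f) (hL : 0 < L) (hbdd : BddBelow (Set.range f)) {A a b : ℝ}
    (hLA : L * A ≤ 1 / 30) (ha : 0 ≤ a) (haA : a ≤ A)
    (hb0 : 0 ≤ b) (hb1 : b ≤ 1) (hab : a * b = (1 - b) * A)
    {g : EuclideanSpace ℝ (Fin d) → Z → EuclideanSpace ℝ (Fin d)}
    (hg : Measurable (Function.uncurry g))
    {s : Ω → EuclideanSpace ℝ (Fin d) × EuclideanSpace ℝ (Fin d)} {ζ : Ω → Z}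
    (hs : Measurable s) (hζ : Measurable ζ) (hindep : IndepFun s ζ μ)
    (hunbiased : ∀ᵐ ω ∂μ, Integrable (fun ω' => g (s ω).1 (ζ ω')) μ ∧
      ∫ ω', g (s ω).1 (ζ ω') ∂μ = gradient f (s ω).1) {σ : ℝ}
    (hvar : ∀ᵐ ω ∂μ, Integrable (fun ω' => ‖g (s ω).1 (ζ ω') - gradient f (s ω).1‖ ^ 2) μ ∧
      ∫ ω', ‖g (s ω).1 (ζ ω') - gradient f (s ω).1‖ ^ 2 ∂μ ≤ σ ^ 2)
    (hfs : Integrable (fun ω => f (s ω).1) μ) (hm : MemLp (fun ω => (s ω).2) 2 μ)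
    {s' : Ω → EuclideanSpace ℝ (Fin d) × EuclideanSpace ℝ (Fin d)}
    (hs' : s' = fun ω => momentumStep a b (s ω) (g (s ω).1 (ζ ω))) :
    Integrable (fun ω => f (s' ω).1) μ ∧ MemLp (fun ω => (s' ω).2) 2 μ ∧
      ∫ ω, lyapunov L A f (s' ω) ∂μ ≤ ∫ ω, lyapunov L A f (s ω) ∂μ
        - 19 / 20 * a * ∫ ω, ‖gradient f (s ω).1‖ ^ 2 ∂μ + 3 / 2 * L * a ^ 2 * σ ^ 2 := by
  have hGm := measurable_gradient (f := f)
  have hX : Measurable fun ω => (s ω).1 := measurable_fst.comp hs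
  have hM : Measurable fun ω => (s ω).2 := measurable_snd.comp hs
  have hG : MemLp (fun ω => gradient f (s ω).1) 2 μ := hf.memLp_gradient hL hbdd hX hfs
  let h : (EuclideanSpace ℝ (Fin d) × EuclideanSpace ℝ (Fin d)) × Z → EuclideanSpace ℝ (Fin d) :=
    fun p => g p.1.1 p.2 - gradient f p.1.1
  have hX' : Measurable fun p :
      (EuclideanSpace ℝ (Fin d) × EuclideanSpace ℝ (Fin d)) × Z => p.1.1 :=
    measurable_fst.comp measurable_fst
  have hh : Measurable h := (hg.comp (hX'.prodMk measurable_snd)).sub (hGm.comp hX')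
  obtain ⟨hN, hNσ⟩ := integral_norm_sq_le_of_indepFun hs hζ hindep hh (c := σ ^ 2) hvar
  have hNm : Measurable fun ω => h (s ω, ζ ω) := hh.comp (hs.prodMk hζ)
  have hN2 : MemLp (fun ω => h (s ω, ζ ω)) 2 μ :=
    (memLp_two_iff_integrable_sq_norm hNm.aestronglyMeasurable).2 hN
  have hgN : ∀ ω, g (s ω).1 (ζ ω) = gradient f (s ω).1 + h (s ω, ζ ω) := fun ω => by simp [h]
  have hM2 : MemLp (fun ω => b • (s ω).2 + (1 - b) • g (s ω).1 (ζ ω)) 2 μ := by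
    simp only [hgN]
    exact (hm.const_smul b).add ((hG.add hN2).const_smul (1 - b))
  have hMm : Measurable fun ω => b • (s ω).2 + (1 - b) • g (s ω).1 (ζ ω) :=
    (hM.const_smul b).add ((hg.comp (hX.prodMk hζ)).const_smul (1 - b))
  have hfs' : Integrable (fun ω => f (s' ω).1) μ := by
    rw [hs']
    exact hf.integrable_comp_sub hbdd hX (hMm.const_smul a) hfs hG (hM2.const_smul a)
  have hm' : MemLp (fun ω => (s' ω).2) 2 μ := by rw [hs']; exact hM2
  have hG' : MemLp (fun ω => gradient f (s' ω).1) 2 μ := by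
    refine hf.memLp_gradient hL hbdd ?_ hfs'
    rw [hs']
    exact hX.sub (hMm.const_smul a)
  refine ⟨hfs', hm', ?_⟩
  obtain ⟨c₁, c₂, hc⟩ := hf.exists_lyapunov_momentumStep_le hLA ha haA hb0 hb1 hab
  obtain ⟨hI, hI0⟩ := integral_inner_eq_zero_of_indepFun hs hζ hindep hh
    (u := fun p => c₁ • gradient f p.1 + c₂ • p.2)
    (((hGm.comp measurable_fst).const_smul c₁).add (measurable_snd.const_smul c₂))
    ((hG.const_smul c₁).add (hm.const_smul c₂)) hN2 (by
      filter_upwards [hunbiased] with ω hω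
      refine ⟨hω.1.sub (integrable_const (gradient f (s ω).1)), ?_⟩
      simp only [h]
      rw [integral_sub hω.1 (integrable_const _), hω.2]
      simp)
  have hG2 := ((memLp_two_iff_integrable_sq_norm hG.1).1 hG).const_mul (19 / 20 * a)
  have hW := integrable_lyapunov (L := L) A hfs hG hm
  have hN3 := hN.const_mul (3 / 2 * L * a ^ 2)
  have key := integral_mono (integrable_lyapunov (L := L) A hfs' hG' hm')
    (((hW.sub hG2).add hI).add hN3) (fun ω => by
      simp only [hs', hgN]
      exact hc (s ω) (h (s ω, ζ ω)))
  refine key.trans ?_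
  rw [integral_add' ((hW.sub hG2).add hI) hN3, integral_add' (hW.sub hG2) hI,
    integral_sub' hW hG2, hI0, integral_const_mul, integral_const_mul]
  have : 3 / 2 * L * a ^ 2 * ∫ ω, ‖h (s ω, ζ ω)‖ ^ 2 ∂μ ≤ 3 / 2 * L * a ^ 2 * σ ^ 2 := by gcongr
  linarith

end Expectation

/-! ### Bookkeeping of stages -/

section Stages

variable {n : ℕ} {T : ℕ → ℕ}

lemma stageEnd_mono : Monotone (stageEnd T) := fun _ _ h =>
  Finset.sum_le_sum_of_subset (Finset.Icc_subset_Icc_right h)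

lemma stageEnd_succ (l : ℕ) : stageEnd T (l + 1) = stageEnd T l + T (l + 1) :=
  Finset.sum_Icc_succ_top (by omega) _

lemma stageOf_eq {l k : ℕ} (hl : l < n) (h1 : stageEnd T l < k) (h2 : k ≤ stageEnd T (l + 1)) :
    stageOf n T k = l + 1 := by
  have : (Finset.Icc 1 n).filter (fun j => stageEnd T j < k) = Finset.Icc 1 l := by
    ext j
    simp only [Finset.mem_filter, Finset.mem_Icc]
    constructor
    · rintro ⟨⟨h3, -⟩, h4⟩
      refine ⟨h3, ?_⟩
      by_contra! h5
      exact absurd (stageEnd_mono (T := T) (Nat.succ_le_of_lt h5)) (by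
        simp only [Nat.succ_eq_add_one]; omega)
    · rintro ⟨h3, h4⟩
      exact ⟨⟨h3, by omega⟩, (stageEnd_mono h4).trans_lt h1⟩
  rw [stageOf, this]
  simp [add_comm]

lemma exists_stage {k : ℕ} (hk : k < stageEnd T n) :
    ∃ l < n, stageEnd T l < k + 1 ∧ k + 1 ≤ stageEnd T (l + 1) := by
  induction n with
  | zero => simp [stageEnd] at hk
  | succ n ih =>
    by_cases h : k < stageEnd T n
    · obtain ⟨l, hl, h'⟩ := ih h
      exact ⟨l, by omega, h'⟩
    · exact ⟨n, by omega, by omega, by omega⟩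

lemma stageOf_mem_Icc {k : ℕ} (hk : k < stageEnd T n) : stageOf n T (k + 1) ∈ Finset.Icc 1 n := by
  obtain ⟨l, hl, h1, h2⟩ := exists_stage hk
  rw [stageOf_eq hl h1 h2, Finset.mem_Icc]
  omega

/-- A sum over all iterations is the sum over the stages of the sums over their iterations. -/
lemma sum_range_stageEnd (u : ℕ → ℝ) :
    ∑ k ∈ Finset.range (stageEnd T n), u (k + 1) =
      ∑ l ∈ Finset.Icc 1 n, ∑ i ∈ Finset.Icc (stageEnd T (l - 1) + 1) (stageEnd T l), u i := by
  induction n with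
  | zero => simp [stageEnd]
  | succ n ih =>
    rw [Finset.sum_Icc_succ_top (by omega), ← ih, Nat.add_sub_cancel]
    have h := stageEnd_mono (T := T) n.le_succ
    rw [← Finset.sum_range_add_sum_Ico _ h]
    congr 1
    rw [Finset.sum_Ico_add' u _ _ 1]
    rfl

end Stages

/-! ### Measurability of the state and its independence from the next sample -/

section State

variable {d : ℕ} {Ω Z : Type*} {n : ℕ} {α β : ℕ → ℝ} {T : ℕ → ℕ}
  {g : EuclideanSpace ℝ (Fin d) → Z → EuclideanSpace ℝ (Fin d)} {ζ : ℕ → Ω → Z}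
  {x₁ : EuclideanSpace ℝ (Fin d)}

lemma state_succ (k : ℕ) : state n α β T g ζ x₁ (k + 1) = fun ω =>
    momentumStep (α (stageOf n T (k + 1))) (β (stageOf n T (k + 1))) (state n α β T g ζ x₁ k ω)
      (g (state n α β T g ζ x₁ k ω).1 (ζ (k + 1) ω)) := rfl

variable [MeasurableSpace Z]

/-- The state after `k` iterations is a measurable function of the first `k` samples. -/
lemma exists_state_eq_comp (hg : Measurable (Function.uncurry g)) (k : ℕ) :
    ∃ F : (Finset.range k → Z) → EuclideanSpace ℝ (Fin d) × EuclideanSpace ℝ (Fin d),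
      Measurable F ∧ state n α β T g ζ x₁ k = fun ω => F fun i => ζ (i + 1) ω := by
  induction k with
  | zero => exact ⟨fun _ => (x₁, 0), measurable_const, rfl⟩
  | succ k ih =>
    obtain ⟨F, hF, hF'⟩ := ih
    let r : (Finset.range (k + 1) → Z) → Finset.range k → Z := fun u i =>
      u ⟨i, Finset.mem_range.2 ((Finset.mem_range.1 i.2).trans k.lt_succ_self)⟩
    have hr : Measurable r := measurable_pi_lambda _ fun i => measurable_pi_apply _
    have hFr := hF.comp hr
    let b := β (stageOf n T (k + 1))
    have hM : Measurable fun u : Finset.range (k + 1) → Z =>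
        b • (F (r u)).2 + (1 - b) • g (F (r u)).1 (u ⟨k, Finset.self_mem_range_succ k⟩) :=
      ((measurable_snd.comp hFr).const_smul b).add
        ((hg.comp ((measurable_fst.comp hFr).prodMk (measurable_pi_apply _))).const_smul (1 - b))
    refine ⟨fun u => momentumStep (α (stageOf n T (k + 1))) b (F (r u))
      (g (F (r u)).1 (u ⟨k, Finset.self_mem_range_succ k⟩)), ?_, ?_⟩
    · exact ((measurable_fst.comp hFr).sub
        (hM.const_smul (α (stageOf n T (k + 1))))).prodMk hM
    · rw [state_succ, hF']

variable [MeasurableSpace Ω]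

lemma measurable_state (hg : Measurable (Function.uncurry g)) (hζ : ∀ k, Measurable (ζ (k + 1)))
    (k : ℕ) : Measurable (state n α β T g ζ x₁ k) := by
  obtain ⟨F, hF, hF'⟩ := exists_state_eq_comp (n := n) (α := α) (β := β) (T := T) (ζ := ζ)
    (x₁ := x₁) hg k
  rw [hF']
  exact hF.comp (measurable_pi_lambda _ fun i => hζ i)

lemma indepFun_state {μ : Measure Ω} (hg : Measurable (Function.uncurry g))
    (hζ : ∀ k, Measurable (ζ (k + 1))) (hindep : iIndepFun (fun k : ℕ => ζ (k + 1)) μ) (k : ℕ) :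
    IndepFun (state n α β T g ζ x₁ k) (ζ (k + 1)) μ := by
  obtain ⟨F, hF, hF'⟩ := exists_state_eq_comp (n := n) (α := α) (β := β) (T := T) (ζ := ζ)
    (x₁ := x₁) hg k
  rw [hF']
  -- The independent family is indexed from `0`: indices below `k` are the samples `1, …, k`, and
  -- index `k` is sample `k + 1`.
  exact (hindep.indepFun_finset (Finset.range k) {k} (by simp) hζ).comp hF
    (measurable_pi_apply (⟨k, Finset.mem_singleton_self k⟩ : ({k} : Finset ℕ)))

end State

/-! ### The absolute constant -/

section Parameters

/-- The worst case is `b = b₁ = c = 1`, with value `24 / √2 < 17`. In general `(24/17)² c⁶ ≤ 2 c² ≤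
c + c²`. -/
lemma bound_coeff_le {b b₁ c : ℝ} (hb : 0 ≤ b) (hbc : b ≤ c) (hb₁ : 0 ≤ b₁) (hb₁c : b₁ ≤ c)
    (hc0 : 0 < c) (hc1 : c ≤ 1) : 24 * b ^ 2 * (b₁ / √(c + c ^ 2)) ≤ 17 := by
  have hpos : 0 < √(c + c ^ 2) := Real.sqrt_pos.2 (by positivity)
  have h2 : b ^ 2 * b₁ ≤ c ^ 3 := by
    calc b ^ 2 * b₁ ≤ c ^ 2 * c := by gcongr
      _ = c ^ 3 := by ring
  have h3 : 24 / 17 * c ^ 3 ≤ √(c + c ^ 2) := by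
    refine Real.le_sqrt_of_sq_le ?_
    have h4 : c ^ 6 ≤ c ^ 2 := pow_le_pow_of_le_one hc0.le hc1 (by norm_num)
    have h5 : c ^ 2 ≤ c := by nlinarith
    nlinarith
  rw [← mul_div_assoc, div_le_iff₀ hpos]
  linarith

end Parameters

end MultistageSGDM

/-! ### Telescoping and assembly -/

theorem mainTheorem4 {d : ℕ} {Ω Z : Type*} [MeasurableSpace Ω] [MeasurableSpace Z]
    (μ : Measure Ω) [IsProbabilityMeasure μ]
    -- the objective: `L`-smooth and bounded below
    (L : ℝ) (hL : 0 < L) (f : EuclideanSpace ℝ (Fin d) → ℝ)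
    (hf : MultistageSGDM.IsLSmooth L f) (hbdd : BddBelow (Set.range f))
    -- the parameters of the `n` stages
    (n : ℕ) (hn : 1 ≤ n) (α β : ℕ → ℝ) (T : ℕ → ℕ) (A₁ A₂ : ℝ)
    (hA₁ : A₁ = 1 / (24 * √2 * L))
    (hα : ∀ i ∈ Finset.Icc 1 n, α i * β i / (1 - β i) = A₁)
    (hT : ∀ i ∈ Finset.Icc 1 n, α i * T i = A₂)
    (hβmono : MonotoneOn β (Set.Icc 1 n)) (hβn : β n < 1) (hβ1 : 1 / 2 ≤ β 1)
    (hcomp : (1 - β 1) / β 1 ≤ 12 * ((1 - β n) / √(β n + β n ^ 2)))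
    (hβT : ∀ i ∈ Finset.Icc 1 n, β i ^ (2 * T i) ≤ 1 / 2)
    -- the stochastic gradients, the samples, and the starting point
    (g : EuclideanSpace ℝ (Fin d) → Z → EuclideanSpace ℝ (Fin d))
    (hg : Measurable (Function.uncurry g))
    (ζ : ℕ → Ω → Z) (hζ : ∀ k, 1 ≤ k → Measurable (ζ k))
    (hindep : iIndepFun (fun k : ℕ => ζ (k + 1)) μ)
    (x₁ : EuclideanSpace ℝ (Fin d)) (x : ℕ → Ω → EuclideanSpace ℝ (Fin d))
    (hx : x = MultistageSGDM.iterate n α β T g ζ x₁)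
    -- unbiasedness: the mean over the sample of iteration `k`, with `xᵏ` fixed, is `∇f(xᵏ)`
    (hunbiased : ∀ k ∈ Finset.Icc 1 (MultistageSGDM.stageEnd T n), ∀ᵐ ω ∂μ,
      Integrable (fun ω' => g (x k ω) (ζ k ω')) μ ∧
        ∫ ω', g (x k ω) (ζ k ω') ∂μ = gradient f (x k ω))
    -- bounded variance, in the same sense
    (σ : ℝ)
    (hvar : ∀ k ∈ Finset.Icc 1 (MultistageSGDM.stageEnd T n), ∀ᵐ ω ∂μ,
      Integrable (fun ω' => ‖g (x k ω) (ζ k ω') - gradient f (x k ω)‖ ^ 2) μ ∧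
        ∫ ω', ‖g (x k ω) (ζ k ω') - gradient f (x k ω)‖ ^ 2 ∂μ ≤ σ ^ 2) :
    (∀ k ∈ Finset.Icc 1 (MultistageSGDM.stageEnd T n),
      Integrable (fun ω => ‖gradient f (x k ω)‖ ^ 2) μ) ∧
    (1 / n * ∑ l ∈ Finset.Icc 1 n, 1 / T l *
        ∑ i ∈ Finset.Icc (MultistageSGDM.stageEnd T (l - 1) + 1) (MultistageSGDM.stageEnd T l),
          ∫ ω, ‖gradient f (x i ω)‖ ^ 2 ∂μ
      ≤ MultistageSGDM.bound n α β A₂ L σ (f x₁ - ⨅ y, f y)) ∧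
    MultistageSGDM.bound n α β A₂ L σ (f x₁ - ⨅ y, f y) ≤
      20 * ((f x₁ - ⨅ y, f y) / (n * A₂) + 1 / n * ∑ l ∈ Finset.Icc 1 n, L * α l * σ ^ 2) := by
  have hβle : ∀ i ∈ Finset.Icc 1 n, β 1 ≤ β i ∧ β i ≤ β n := fun i hi => by
    obtain ⟨h1, h2⟩ := Finset.mem_Icc.1 hi
    exact ⟨hβmono ⟨le_rfl, hn⟩ ⟨h1, h2⟩ h1, hβmono ⟨h1, h2⟩ ⟨hn, le_rfl⟩ h2⟩
  have hA₁pos : 0 < A₁ := by rw [hA₁]; positivity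
  have hLA : L * A₁ ≤ 1 / 30 := by
    have h2 : (5 / 4 : ℝ) ≤ √2 := Real.le_sqrt_of_sq_le (by norm_num)
    have h3 : L * A₁ = 1 / (24 * √2) := by rw [hA₁]; field_simp
    rw [h3]
    exact one_div_le_one_div_of_le (by norm_num) (by linarith)
  have hab : ∀ i ∈ Finset.Icc 1 n, α i * β i = (1 - β i) * A₁ := fun i hi => by
    have h1 : 1 - β i ≠ 0 := by linarith [(hβle i hi).2]
    rw [← hα i hi]; field_simp
  have hαpos : ∀ i ∈ Finset.Icc 1 n, 0 < α i := fun i hi => by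
    have h1 := hβle i hi
    refine pos_of_mul_pos_left (b := β i) ?_ (by linarith)
    rw [hab i hi]
    exact mul_pos (by linarith) hA₁pos
  -- Since `β i ≥ 1/2`, `1 - β i ≤ β i`; with `α β = (1 - β) A₁` this gives the step-size condition
  -- of the one-step decrease.
  have hαle : ∀ i ∈ Finset.Icc 1 n, α i ≤ A₁ := fun i hi => by
    have h1 := hβle i hi
    have h2 : (1 - β i) * A₁ ≤ β i * A₁ := by gcongr; linarith
    rw [← hab i hi, mul_comm] at h2
    exact le_of_mul_le_mul_left h2 (by linarith)
  have hTpos : ∀ i ∈ Finset.Icc 1 n, (0 : ℝ) < T i := fun i hi => by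
    rw [Nat.cast_pos]
    refine Nat.pos_of_ne_zero fun h => ?_
    -- An empty stage would give `β i ^ 0 = 1 ≤ 1/2`.
    have := hβT i hi
    norm_num [h] at this
  have h1n : 1 ∈ Finset.Icc 1 n := Finset.mem_Icc.2 ⟨le_rfl, hn⟩
  have hA₂ : 0 < A₂ := by rw [← hT 1 h1n]; exact mul_pos (hαpos 1 h1n) (hTpos 1 h1n)
  have hn0 : (0 : ℝ) < n := by exact_mod_cast hn
  obtain ⟨Δ, hΔ⟩ : ∃ Δ, Δ = f x₁ - ⨅ y, f y := ⟨_, rfl⟩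
  have hΔ0 : 0 ≤ Δ := by rw [hΔ]; exact sub_nonneg.2 (ciInf_le hbdd x₁)
  have hζ' : ∀ k, Measurable (ζ (k + 1)) := fun k => hζ _ (by omega)
  have hxk : ∀ k, x (k + 1) = fun ω => (MultistageSGDM.state n α β T g ζ x₁ k ω).1 := fun k => by
    rw [hx]; rfl
  rw [← hΔ]
  obtain ⟨W, hW⟩ : ∃ W : ℕ → ℝ, ∀ k, W k = ∫ ω, MultistageSGDM.lyapunov L A₁ f
    (MultistageSGDM.state n α β T g ζ x₁ k ω) ∂μ := ⟨_, fun _ => rfl⟩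
  obtain ⟨e, he⟩ : ∃ e : ℕ → ℝ, ∀ k, e k = ∫ ω, ‖gradient f (x k ω)‖ ^ 2 ∂μ := ⟨_, fun _ => rfl⟩
  obtain ⟨a, ha⟩ : ∃ a : ℕ → ℝ, ∀ k, a k = α (MultistageSGDM.stageOf n T k) := ⟨_, fun _ => rfl⟩
  have hstate := MultistageSGDM.measurable_state (n := n) (α := α) (β := β) (T := T) (x₁ := x₁)
    hg hζ'
  -- The two integrability claims are carried along with the telescoped inequality, because each
  -- step needs them to take expectations.
  have hmain : ∀ k ≤ MultistageSGDM.stageEnd T n,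
      Integrable (fun ω => f (MultistageSGDM.state n α β T g ζ x₁ k ω).1) μ ∧
      MemLp (fun ω => (MultistageSGDM.state n α β T g ζ x₁ k ω).2) 2 μ ∧
      W k + 19 / 20 * ∑ j ∈ Finset.range k, a (j + 1) * e (j + 1) ≤
        f x₁ + 3 / 2 * L * σ ^ 2 * ∑ j ∈ Finset.range k, a (j + 1) ^ 2 := by
    intro k
    induction k with
    | zero =>
      intro _
      refine ⟨integrable_const (f x₁), memLp_const 0, ?_⟩
      simp [hW, MultistageSGDM.state, MultistageSGDM.lyapunov]
    | succ k ih =>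
      intro hk
      obtain ⟨h1, h2, h3⟩ := ih (by omega)
      have hl := MultistageSGDM.stageOf_mem_Icc (n := n) (T := T) hk
      have hk' : k + 1 ∈ Finset.Icc 1 (MultistageSGDM.stageEnd T n) :=
        Finset.mem_Icc.2 ⟨by omega, hk⟩
      have hu := hunbiased _ hk'
      have hv := hvar _ hk'
      have hβl := hβle _ hl
      rw [hxk] at hu hv
      obtain ⟨h4, h5, h6⟩ := hf.integral_lyapunov_momentumStep_le hL hbdd hLA (hαpos _ hl).le
        (hαle _ hl) (by linarith) (by linarith) (hab _ hl) hg (hstate k) (hζ' k)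
        (MultistageSGDM.indepFun_state hg hζ' hindep k) hu hv h1 h2
        (MultistageSGDM.state_succ k)
      refine ⟨h4, h5, ?_⟩
      have hek : e (k + 1) =
          ∫ ω, ‖gradient f (MultistageSGDM.state n α β T g ζ x₁ k ω).1‖ ^ 2 ∂μ := by
        rw [he, hxk]
      rw [← hW, ← hW, ← hek, ← ha] at h6
      rw [Finset.sum_range_succ, Finset.sum_range_succ]
      linarith
  refine ⟨fun k hk => ?_, ?_, ?_⟩
  · obtain ⟨k, rfl⟩ := Nat.exists_eq_add_of_le' (Finset.mem_Icc.1 hk).1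
    have h1 := (hmain k ((Nat.le_succ k).trans (Finset.mem_Icc.1 hk).2)).1
    have h2 := hf.memLp_gradient hL hbdd (measurable_fst.comp (hstate k)) h1
    rw [hxk]
    exact (memLp_two_iff_integrable_sq_norm h2.1).1 h2
  · obtain ⟨h1, h2, h3⟩ := hmain _ le_rfl
    have hWn : ⨅ y, f y ≤ W (MultistageSGDM.stageEnd T n) := by
      have hI := MultistageSGDM.integrable_lyapunov (L := L) A₁ h1
        (hf.memLp_gradient hL hbdd (measurable_fst.comp (hstate _)) h1) h2
      have := integral_mono (integrable_const (⨅ y, f y)) hI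
        fun ω => hf.iInf_le_lyapunov hbdd A₁ _
      rw [hW]
      simpa using this
    have hstage : ∀ l ∈ Finset.Icc 1 n, ∀ i ∈ Finset.Icc (MultistageSGDM.stageEnd T (l - 1) + 1)
        (MultistageSGDM.stageEnd T l), a i = α l := fun l hl i hi => by
      obtain ⟨l, rfl⟩ := Nat.exists_eq_add_of_le' (Finset.mem_Icc.1 hl).1
      obtain ⟨h4, h5⟩ := Finset.mem_Icc.1 hi
      rw [ha, MultistageSGDM.stageOf_eq (Finset.mem_Icc.1 hl).2 h4 h5]
    rw [MultistageSGDM.sum_range_stageEnd fun i => a i * e i,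
      MultistageSGDM.sum_range_stageEnd fun i => a i ^ 2] at h3
    have hs1 : ∀ l ∈ Finset.Icc 1 n, ∑ i ∈ Finset.Icc (MultistageSGDM.stageEnd T (l - 1) + 1)
        (MultistageSGDM.stageEnd T l), a i * e i =
        A₂ * (1 / T l * ∑ i ∈ Finset.Icc (MultistageSGDM.stageEnd T (l - 1) + 1)
          (MultistageSGDM.stageEnd T l), e i) := fun l hl => by
      rw [Finset.sum_congr rfl fun i hi => by rw [hstage l hl i hi], ← Finset.mul_sum, ← hT l hl]
      have := (hTpos l hl).ne'
      field_simp
    have hs2 : ∀ l ∈ Finset.Icc 1 n, ∑ i ∈ Finset.Icc (MultistageSGDM.stageEnd T (l - 1) + 1)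
        (MultistageSGDM.stageEnd T l), a i ^ 2 = A₂ * α l := fun l hl => by
      rw [Finset.sum_congr rfl fun i hi => by rw [hstage l hl i hi], Finset.sum_const,
        Nat.card_Icc, ← hT l hl]
      obtain ⟨l, rfl⟩ := Nat.exists_eq_add_of_le' (Finset.mem_Icc.1 hl).1
      rw [MultistageSGDM.stageEnd_succ, Nat.add_sub_cancel, nsmul_eq_mul]
      have : MultistageSGDM.stageEnd T l + T (l + 1) + 1 - (MultistageSGDM.stageEnd T l + 1)
          = T (l + 1) := by omega
      rw [this]
      ring
    rw [Finset.sum_congr rfl hs1, Finset.sum_congr rfl hs2, ← Finset.mul_sum,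
      ← Finset.mul_sum] at h3
    simp only [← he]
    obtain ⟨Q, hQ⟩ : ∃ Q, Q = ∑ l ∈ Finset.Icc 1 n, 1 / (T l : ℝ) *
      ∑ i ∈ Finset.Icc (MultistageSGDM.stageEnd T (l - 1) + 1)
        (MultistageSGDM.stageEnd T l), e i := ⟨_, rfl⟩
    rw [← hQ] at h3 ⊢
    have hα0 : 0 ≤ ∑ l ∈ Finset.Icc 1 n, α l := Finset.sum_nonneg fun l hl => (hαpos l hl).le
    have hQle : Q ≤ 2 * Δ / A₂ + 3 * L * σ ^ 2 * ∑ l ∈ Finset.Icc 1 n, α l := by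
      have h4 : 0 ≤ L * σ ^ 2 * (A₂ * ∑ l ∈ Finset.Icc 1 n, α l) := by positivity
      -- The telescoped inequality gives the factor `20/19` on `Δ` and `30/19` on the noise; these
      -- are relaxed to `2` and `3`.
      have h5 : A₂ * Q ≤ 2 * Δ + A₂ * (3 * L * σ ^ 2 * ∑ l ∈ Finset.Icc 1 n, α l) := by
        linarith
      rw [div_add' _ _ _ hA₂.ne', le_div_iff₀ hA₂]
      linarith
    -- The summand `3 L α_l σ²` already suffices; the remaining term of the stated bound is
    -- nonnegative.
    have hsum : 3 * L * σ ^ 2 * ∑ l ∈ Finset.Icc 1 n, α l ≤ ∑ l ∈ Finset.Icc 1 n,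
        (24 * β l ^ 2 * (β 1 / √(β n + β n ^ 2)) * L + 3 * L) * α l * σ ^ 2 := by
      rw [Finset.mul_sum]
      refine Finset.sum_le_sum fun l hl => ?_
      have h4 := hαpos l hl
      have h5 : 0 ≤ 24 * β l ^ 2 * (β 1 / √(β n + β n ^ 2)) * L * α l * σ ^ 2 := by
        have : 0 ≤ β 1 := by linarith
        positivity
      linarith
    calc 1 / (n : ℝ) * Q ≤ 1 / n * (2 * Δ / A₂ + 3 * L * σ ^ 2 * ∑ l ∈ Finset.Icc 1 n, α l) := by
          gcongr
      _ = 2 * Δ / (n * A₂) + 1 / n * (3 * L * σ ^ 2 * ∑ l ∈ Finset.Icc 1 n, α l) := by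
          field_simp
      _ ≤ _ := by
          unfold MultistageSGDM.bound
          gcongr
  · unfold MultistageSGDM.bound
    have h1 : 2 * Δ / (n * A₂) ≤ 20 * (Δ / (n * A₂)) := by
      rw [mul_div_assoc]
      gcongr
      norm_num
    -- The constant is `20 = 17 + 3`.
    have h2 : ∑ l ∈ Finset.Icc 1 n, (24 * β l ^ 2 * (β 1 / √(β n + β n ^ 2)) * L + 3 * L) * α l
        * σ ^ 2 ≤ 20 * ∑ l ∈ Finset.Icc 1 n, L * α l * σ ^ 2 := by
      rw [Finset.mul_sum]
      refine Finset.sum_le_sum fun l hl => ?_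
      have h3 := hβle l hl
      have h4 := hαpos l hl
      have h5 := MultistageSGDM.bound_coeff_le (b := β l) (b₁ := β 1) (c := β n) (by linarith) h3.2
        (by linarith) (hβle 1 h1n).2 (by linarith) hβn.le
      have h6 : 0 ≤ L * α l * σ ^ 2 := by positivity
      have h7 := mul_le_mul_of_nonneg_right h5 h6
      linarith
    have h8 := mul_le_mul_of_nonneg_left h2 (one_div_nonneg.2 hn0.le)
    linarith
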